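/- Let $A=\{a_1,\dots,a_m\}$ be a finite alphabet, and write $\widetilde A=A\cup A^{-1}$, where $A^{-1}$ is a disjoint set of formal inverses; extend $a\mapsto a^{-1}$ to the involution $w\mapsto w^{-1}$ of the free monoid $\widetilde A^*$ (reverse the word and invert each letter). Let $\rho_A$ be the congruence on $\widetilde A^*$ generated by all pairs $(ww^{-1}w,\,w)$ and $(uu^{-1}vv^{-1},\,vv^{-1}uu^{-1})$ with $u,v,w\in\widetilde A^*$. For a finite set $R\subseteq\widetilde A^*\times\widetilde A^*$, let $M=\mathrm{Inv}\langle A\mid R\rangle=\widetilde A^*/\tau$, where $\tau=(\rho_A\cup R)^\sharp$ is the congruence generated by $\rho_A\cup R$. For $1\le i\le m$ put $A_i=A\setminus\{a_i\}$, let $\theta_i:\widetilde A^*\to\widetilde{A_i}^*$ be the homomorphism deleting all occurrences of $a_i$ and $a_i^{-1}$, and let $M_i=\mathrm{Inv}\langle A_i\mid R_i\rangle=\widetilde{A_i}^*/\tau_i$, where $R_i=\{(r\theta_i,s\theta_i) : (r,s)\in R\}$ and $\tau_i=(\rho_{A_i}\cup R_i)^\sharp$. The eraser morphism is the monoid homomorphism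 $$\epsilon: M\to\prod_{i=1}^m M_i,\qquad (w\tau)\epsilon=\big((w\theta_1)\tau_1,\dots,(w\theta_m)\tau_m\big).$$ A monoid is finite-$\mathcal J$-above if each of its elements $v$ has only finitely many factors, i.e. elements $u$ such that $v=xuy$ for some $x,y$ in the monoid. The membership problem for a subset $L$ of a finitely generated monoid $N$ is decidable if, for every finite family of elements of $N$ (in particular, for every finite generating family), there is an algorithm which, given a word over that family, decides whether the element of $N$ represented by the word lies in $L$. **Corollary.** If $M_i$ is finite-$\mathcal J$-above for every $i=1,\dots,m$, then the membership problem is decidable for $\mathrm{Im}\,\epsilon$ in $\prod_{i=1}^m M_i$. In particular, with no further hypothesis, this holds for the presentation $\mathrm{Inv}\langle A\mid\emptyset\rangle$ of the free inverse monoid on $A$, that is, for $\epsilon:\mathrm{FIM}_A\to\prod_{i=1}^m \mathrm{FIM}_{A_i}$. -/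

import Mathlib

universe u

namespace InvPres

/-- Words over the alphabet `A ∪ A⁻¹`: the letter `(a, true)` is `a`, and `(a, false)` is `a⁻¹`. -/
abbrev Word (A : Type u) : Type u := FreeMonoid (A × Bool)

/-- The formal inverse of a word: reverse it and invert every letter. -/
def wordInv {A : Type u} (w : Word A) : Word A :=
  FreeMonoid.ofList (FreeGroup.invRev (FreeMonoid.toList w))

/-- The defining pairs of the Vagner congruence. -/
inductive VagnerRel (A : Type u) : Word A → Word A → Prop
  | inv_law (w : Word A) : VagnerRel A (w * wordInv w * w) w
  | comm_law (x y : Word A) :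
      VagnerRel A (x * wordInv x * (y * wordInv y)) (y * wordInv y * (x * wordInv x))

/-- The Vagner congruence; its quotient is the free inverse monoid on `A`. -/
def vagnerCon (A : Type u) : Con (Word A) := conGen (VagnerRel A)

/-- The congruence generated by the Vagner congruence and the relations `R`. -/
def presCon {A : Type u} (R : Set (Word A × Word A)) : Con (Word A) :=
  conGen fun x y => vagnerCon A x y ∨ (x, y) ∈ R

/-- The inverse monoid `Inv⟨A | R⟩`. -/
abbrev Presented {A : Type u} (R : Set (Word A × Word A)) : Type u := (presCon R).Quotient

/-- The alphabet `A` without the letter `a`. -/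
abbrev Rest (A : Type u) (a : A) : Type u := {b : A // b ≠ a}

/-- The homomorphism deleting all occurrences of `a` and `a⁻¹` from a word. -/
def erase {A : Type u} [DecidableEq A] (a : A) : Word A →* Word (Rest A a) :=
  FreeMonoid.lift fun l : A × Bool =>
    if h : l.1 = a then 1 else FreeMonoid.of ((⟨l.1, h⟩ : Rest A a), l.2)

/-- The relations obtained by deleting `a` and `a⁻¹` from both sides of every relation. -/
def erasedRel {A : Type u} [DecidableEq A] (R : Set (Word A × Word A)) (a : A) :
    Set (Word (Rest A a) × Word (Rest A a)) :=
  (fun r => (erase a r.1, erase a r.2)) '' R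

/-- The erased component of `Inv⟨A | R⟩` at the letter `a`. -/
abbrev Component {A : Type u} [DecidableEq A] (R : Set (Word A × Word A)) (a : A) : Type u :=
  Presented (erasedRel R a)

theorem wordInv_mul {A : Type u} (x y : Word A) : wordInv (x * y) = wordInv y * wordInv x := by
  simp [wordInv, FreeGroup.invRev]

theorem erase_wordInv {A : Type u} [DecidableEq A] (a : A) (w : Word A) :
    erase a (wordInv w) = wordInv (erase a w) := by
  induction w using FreeMonoid.inductionOn' with
  | one => rfl
  | of_mul l w ih =>
    rw [wordInv_mul, map_mul, map_mul, wordInv_mul, ih]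
    congr 1
    have h1 : wordInv (FreeMonoid.of l) = FreeMonoid.of (l.1, !l.2) := rfl
    rw [h1]
    simp only [erase, FreeMonoid.lift_eval_of]
    split_ifs <;> rfl

theorem presCon_le_ker {A : Type u} [DecidableEq A] (R : Set (Word A × Word A)) (a : A) :
    presCon R ≤ Con.ker ((presCon (erasedRel R a)).mk'.comp (erase a)) := by
  have key : vagnerCon A ≤ Con.ker ((presCon (erasedRel R a)).mk'.comp (erase a)) := by
    refine Con.conGen_le.2 ?_
    intro x y h
    refine (Con.eq _).2 (ConGen.Rel.of _ _ (Or.inl (ConGen.Rel.of _ _ ?_)))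
    cases h with
    | inv_law w =>
      simpa only [map_mul, erase_wordInv] using VagnerRel.inv_law (erase a y)
    | comm_law x y =>
      simpa only [map_mul, erase_wordInv] using VagnerRel.comm_law (erase a x) (erase a y)
  refine Con.conGen_le.2 ?_
  rintro x y (h | h)
  · exact key h
  · exact (Con.eq _).2 (ConGen.Rel.of _ _ (Or.inr ⟨(x, y), h, rfl⟩))

/-- The component of the eraser morphism at `a`: the class of `w` goes to the class of `w` with
all `a` and `a⁻¹` deleted. -/
def eraserAt {A : Type u} [DecidableEq A] (R : Set (Word A × Word A)) (a : A) :
    Presented R →* Component R a :=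
  (presCon R).lift ((presCon (erasedRel R a)).mk'.comp (erase a)) (presCon_le_ker R a)

/-- The eraser morphism into the direct product of all erased components. -/
def eraser {A : Type u} [DecidableEq A] (R : Set (Word A × Word A)) :
    Presented R →* ((a : A) → Component R a) :=
  MonoidHom.pi fun a => eraserAt R a

/-- A monoid is finite-J-above if each element `v` has only finitely many factors, that is,
elements `x` with `v = p * x * q` for some `p`, `q`. -/
def FiniteJAbove (M : Type u) [Monoid M] : Prop :=
  ∀ v : M, {x : M | ∃ p q : M, v = p * x * q}.Finite

/-- Decidability of the membership problem for a subset `L` of a finitely generated monoid `N`: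
for every finite family `g` of elements (in particular, for every finite generating family), there
is an algorithm that decides, given a word over the index set of `g`, whether the element of `N`
which it represents lies in `L`. -/
def DecidableMembership (N : Type u) [Monoid N] (L : Set N) : Prop :=
  ∀ (k : ℕ) (g : Fin k → N), ComputablePred fun w : List (Fin k) => (w.map g).prod ∈ L

end InvPres

/-! The image of the eraser morphism is a finitely generated submonoid of a finite product of
finitely presented inverse monoids, so it suffices to decide membership in such submonoids. By
Post's theorem (`ComputablePred.computable_iff_re_compl_re`), it is enough to enumerate both
membership and non-membership.

Membership is witnessed by a word over the generators together with a derivation from the defining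
relations (`exists_presCon_iff_foldl`). Non-membership is witnessed by a finite quotient in which
the element stays outside the submonoid's image; such quotients are coded as multiplication tables
and checked mechanically. They exist because the non-factors of `v` can be collapsed to a single
class: the Rees quotient is finite by finite-J-aboveness, and `v` is alone in its class
(`factorCon_eq`), so nothing outside `v` is mapped onto it. The factor sets themselves never have to
be computed.

The product reduces to a single monoid: it is presented on the disjoint union of the alphabets by
adding commutation of letters from distinct factors (`nonempty_mulEquiv_pi`), and finite-J-aboveness
passes to finite products. For the free case, Munn trees confine each factor of `v` to finitely many
normal forms (`finiteJAbove_free`). -/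

namespace InvPres

/-! ### Inverse operations and presentations -/

section Basic

variable {A : Type u}

theorem wordInv_one : wordInv (1 : Word A) = 1 := rfl

theorem wordInv_of (l : A × Bool) : wordInv (FreeMonoid.of l) = FreeMonoid.of (l.1, !l.2) := rfl

theorem wordInv_wordInv (w : Word A) : wordInv (wordInv w) = w := by
  induction w using FreeMonoid.inductionOn' with
  | one => rfl
  | of_mul l w ih =>
    rw [wordInv_mul, wordInv_mul, ih, wordInv_of, wordInv_of]
    simp

theorem presCon_of_vagner (R : Set (Word A × Word A)) {x y : Word A} (h : VagnerRel A x y) :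
    presCon R x y :=
  ConGen.Rel.of _ _ (Or.inl (ConGen.Rel.of _ _ h))

theorem presCon_of_mem {R : Set (Word A × Word A)} {x y : Word A} (h : (x, y) ∈ R) :
    presCon R x y :=
  ConGen.Rel.of _ _ (Or.inr h)

theorem presCon_le {R : Set (Word A × Word A)} {c : Con (Word A)}
    (hv : ∀ x y, VagnerRel A x y → c x y) (hR : ∀ x y, (x, y) ∈ R → c x y) :
    presCon R ≤ c := by
  refine Con.conGen_le.2 ?_
  rintro x y (h | h)
  · exact Con.conGen_le.2 hv h
  · exact hR x y h

/-- A homomorphism into a monoid with a compatible inverse operation respects the presentation as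
soon as it respects `R`. -/
theorem presCon_le_ker_of_inv {T : Type*} [Monoid T] (φ : Word A →* T) (i : T → T)
    (h1 : ∀ x, x * i x * x = x) (h2 : ∀ x y, x * i x * (y * i y) = y * i y * (x * i x))
    (h3 : ∀ x y, i (x * y) = i y * i x)
    (h4 : ∀ l : A × Bool, i (φ (FreeMonoid.of l)) = φ (FreeMonoid.of (l.1, !l.2)))
    {R : Set (Word A × Word A)} (hR : ∀ x y, (x, y) ∈ R → φ x = φ y) :
    presCon R ≤ Con.ker φ := by
  have h5 : ∀ w, φ (wordInv w) = i (φ w) := by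
    intro w
    induction w using FreeMonoid.inductionOn' with
    -- The law `h1` at the identity already forces `i 1 = 1`.
    | one => simpa [wordInv_one] using (h1 1).symm
    | of_mul l w ih => rw [wordInv_mul, map_mul, map_mul, h3, ih, h4, wordInv_of]
  refine presCon_le ?_ hR
  rintro x y (w | ⟨x, y⟩)
  · change φ _ = φ _
    rw [map_mul, map_mul, h5, h1]
  · change φ _ = φ _
    simp only [map_mul, h5, h2]

/-- Formal inversion descends to every quotient in which the Vagner relations hold. -/
theorem map_wordInv_congr {T : Type*} [Monoid T] (φ : Word A →* T)
    (hφ : ∀ x y, VagnerRel A x y → φ x = φ y) {x y : Word A} (h : φ x = φ y) :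
    φ (wordInv x) = φ (wordInv y) := by
  have a1 := hφ _ _ (.inv_law x)
  have a2 := hφ _ _ (.inv_law (wordInv x))
  have b1 := hφ _ _ (.inv_law y)
  have b2 := hφ _ _ (.inv_law (wordInv y))
  have c1 := hφ _ _ (.comm_law x y)
  have c2 := hφ _ _ (.comm_law (wordInv x) (wordInv y))
  simp only [wordInv_wordInv, map_mul, ← h] at a1 a2 b1 b2 c1 c2
  generalize φ x = m at *
  generalize φ (wordInv x) = s at *
  generalize φ (wordInv y) = t at *
  -- Uniqueness of inverses: `s` and `t` are both inverses of `m`, and the commuting idempotents `s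
  -- * m`, `t * m` and `m * s`, `m * t` force them to agree.
  calc s = s * (m * t * m) * s := by rw [b1, a2]
    _ = s * m * (t * m) * s := by simp only [mul_assoc]
    _ = t * m * (s * m * s) := by rw [c2]; simp only [mul_assoc]
    _ = t * m * s := by rw [a2]
    _ = t * m * t * (m * s) := by rw [b2]; simp only [mul_assoc]
    _ = t * (m * s * (m * t)) := by rw [c1]; simp only [mul_assoc]
    _ = t * (m * s * m) * t := by simp only [mul_assoc]
    _ = t := by rw [a1, b2]

/-- A surjective homomorphism satisfying the Vagner relations induces an inverse operation. -/
theorem exists_inv_of_surjective {T : Type*} [Monoid T] (φ : Word A →* T)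
    (hs : Function.Surjective φ) (hφ : ∀ x y, VagnerRel A x y → φ x = φ y) :
    ∃ i : T → T, (∀ x, x * i x * x = x) ∧ (∀ x y, x * i x * (y * i y) = y * i y * (x * i x)) ∧
      (∀ x y, i (x * y) = i y * i x) ∧
      ∀ l : A × Bool, i (φ (FreeMonoid.of l)) = φ (FreeMonoid.of (l.1, !l.2)) := by
  choose g hg using hs
  -- The inverse does not depend on the chosen preimage word.
  have key : ∀ w, φ (wordInv (g (φ w))) = φ (wordInv w) :=
    fun w => map_wordInv_congr φ hφ (hg _)
  refine ⟨fun t => φ (wordInv (g t)), fun x => ?_, fun x y => ?_, fun x y => ?_, fun l => ?_⟩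
  · have := hφ _ _ (.inv_law (g x))
    simpa only [map_mul, hg] using this
  · have := hφ _ _ (.comm_law (g x) (g y))
    simpa only [map_mul, hg] using this
  · have := key (g x * g y)
    rw [map_mul, hg, hg] at this
    dsimp only
    rw [this, wordInv_mul, map_mul]
  · dsimp only
    rw [key, wordInv_of]

/-- Every hom into a quotient of words lifts to words. -/
theorem exists_lift {Γ : Type*} {c : Con (Word A)}
    (ψ : FreeMonoid Γ →* c.Quotient) :
    ∃ Ψ : Γ → Word A, ∀ w, ψ w = c.mk' (FreeMonoid.lift Ψ w) := by
  choose g hg using fun l => Con.mk'_surjective (c := c) (ψ (FreeMonoid.of l))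
  refine ⟨g, fun w => ?_⟩
  have : ψ = c.mk'.comp (FreeMonoid.lift g) := FreeMonoid.hom_eq fun l => by simpa using (hg l).symm
  rw [this]; rfl

end Basic

/-! ### Rees quotients by the ideal of non-factors -/

section Rees

variable {M : Type u} [Monoid M]

/-- The Rees congruence collapsing all elements that are not factors of `v`. -/
def factorCon (v : M) : Con M where
  r x y := x = y ∨ (¬ ∃ p q, v = p * x * q) ∧ ¬ ∃ p q, v = p * y * q
  iseqv := by
    refine ⟨fun x => Or.inl rfl, ?_, ?_⟩
    · rintro x y (h | h)
      · exact Or.inl h.symm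
      · exact Or.inr h.symm
    · rintro x y z (rfl | h) (rfl | h')
      · exact Or.inl rfl
      · exact Or.inr h'
      · exact Or.inr h
      · exact Or.inr ⟨h.1, h'.2⟩
  mul' := by
    have hl : ∀ a b : M, (¬ ∃ p q, v = p * a * q) → ¬ ∃ p q, v = p * (a * b) * q := by
      rintro a b h ⟨p, q, e⟩
      exact h ⟨p, b * q, by simpa only [mul_assoc] using e⟩
    have hr : ∀ a b : M, (¬ ∃ p q, v = p * b * q) → ¬ ∃ p q, v = p * (a * b) * q := by
      rintro a b h ⟨p, q, e⟩
      exact h ⟨p * a, q, by simpa only [mul_assoc] using e⟩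
    rintro w x y z (rfl | h) (rfl | h')
    · exact Or.inl rfl
    · exact Or.inr ⟨hr _ _ h'.1, hr _ _ h'.2⟩
    · exact Or.inr ⟨hl _ _ h.1, hl _ _ h.2⟩
    · exact Or.inr ⟨hl _ _ h.1, hl _ _ h.2⟩

/-- Since `v` is a factor of itself, it is not in the collapsed ideal. This is what makes the
quotient separate `v` from any subset avoiding it. -/
theorem factorCon_eq {v x : M} (h : factorCon v v x) : v = x := by
  rcases h with h | h
  · exact h
  · exact (h.1 ⟨1, 1, by simp⟩).elim

theorem finite_factorCon_quotient {v : M} (h : {x : M | ∃ p q : M, v = p * x * q}.Finite) :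
    Finite (factorCon v).Quotient := by
  have hs : ((fun x : M => (x : (factorCon v).Quotient)) '' {x : M | ∃ p q : M, v = p * x * q}ᶜ).Finite := by
    refine Set.Subsingleton.finite ?_
    rintro _ ⟨x, hx, rfl⟩ _ ⟨y, hy, rfl⟩
    exact (Con.eq _).2 (Or.inr ⟨hx, hy⟩)
  refine Set.finite_univ_iff.1 (((h.image fun x : M => (x : (factorCon v).Quotient)).union hs).subset ?_)
  intro t _
  induction t using Con.induction_on with
  | H x =>
    by_cases hx : ∃ p q : M, v = p * x * q
    · exact Or.inl ⟨x, hx, rfl⟩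
    · exact Or.inr ⟨x, hx, rfl⟩

end Rees

/-! ### Recursive enumerability and primitive recursion tools -/

section Computability

/-- Unbounded search over the codes of `β`. Numbers that decode to nothing count as failures, so the
searched function is total. -/
theorem rePred_exists {α β : Type*} [Primcodable α] [Primcodable β] {p : α × β → Prop}
    (hp : PrimrecPred p) : REPred fun a => ∃ b, p (a, b) := by
  classical
  have hd : Primrec fun x : α × β => decide (p x) := hp.decide
  have h1 : Primrec₂ fun (a : α) (n : ℕ) =>
      ((Encodable.decode n : Option β).map fun b => decide (p (a, b))).getD false := by
    refine Primrec.option_getD.comp (Primrec.option_map (Primrec.decode.comp Primrec.snd) ?_)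
      (Primrec.const false)
    exact hd.comp (Primrec.pair (Primrec.fst.comp Primrec.fst) Primrec.snd)
  have h2 : Partrec₂ fun (a : α) (n : ℕ) => (Part.some
      (((Encodable.decode n : Option β).map fun b => decide (p (a, b))).getD false) : Part Bool) :=
    h1.to_comp.partrec₂
  refine (Partrec.rfind h2).dom_re.of_eq fun a => ?_
  refine Nat.rfind_dom.trans ?_
  constructor
  · rintro ⟨n, hn, -⟩
    rw [Part.mem_some_iff] at hn
    rcases hb : (Encodable.decode n : Option β) with _ | b
    · simp [hb] at hn
    · simp only [hb, Option.map_some, Option.getD_some] at hn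
      exact ⟨b, of_decide_eq_true hn.symm⟩
  · rintro ⟨b, hb⟩
    refine ⟨Encodable.encode b, ?_, fun _ => trivial⟩
    rw [Part.mem_some_iff]
    simp [hb]

theorem exists_primcodable_of_finite (α : Type*) [Finite α] : Nonempty (Primcodable α) :=
  let ⟨_, ⟨e⟩⟩ := Finite.exists_equiv_fin α
  ⟨Primcodable.ofEquiv _ e⟩

theorem exists_list_getD (N : ℕ) {α : Type*} (d : α) (g : ℕ → α) :
    ∃ l : List α, ∀ i < N, l.getD i d = g i :=
  ⟨(List.range N).map g, fun i hi => by simp [List.getD_eq_getElem?_getD, hi]⟩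

/-- The codes of a finite type are bounded, though not necessarily consecutive; unused positions are
filled with `0`. -/
theorem exists_list_getD_encode {L : Type*} [Finite L] [Encodable L] (g : L → ℕ) :
    ∃ t : List ℕ, ∀ l : L, t.getD (Encodable.encode l) 0 = g l := by
  obtain ⟨N, hN⟩ := (Set.finite_range (Encodable.encode : L → ℕ)).bddAbove
  obtain ⟨t, ht⟩ := exists_list_getD (N + 1) 0
    fun i => ((Encodable.decode i : Option L).map g).getD 0
  exact ⟨t, fun l => by
    rw [ht _ (Nat.lt_succ_of_le (hN ⟨l, rfl⟩))]; simp⟩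

theorem primrec_flatMap_const {α β γ : Type*} [Primcodable α] [Primcodable β] [Primcodable γ]
    [Finite β] {f : α → List β} (hf : Primrec f) (g : β → List γ) :
    Primrec fun a => (f a).flatMap g :=
  Primrec.list_flatMap hf ((Primrec.dom_finite g).comp Primrec.snd).to₂

theorem primrec_wordInv {A : Type u} [Finite A] [Primcodable A] {α : Type*} [Primcodable α]
    {f : α → List (A × Bool)} (hf : Primrec f) :
    Primrec fun a => (FreeGroup.invRev (f a) : List (A × Bool)) :=
  Primrec.list_reverse.comp (Primrec.list_map hf
    ((Primrec.dom_finite fun l : A × Bool => (l.1, !l.2)).comp Primrec.snd).to₂)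

end Computability

/-! ### Derivations as lists of rewriting instructions -/

section Derivation

variable {A : Type u}

/-- The rewriting rules, parametrised by two words and an index. -/
def rule (Q : List (List (A × Bool) × List (A × Bool))) (w : List (A × Bool) × List (A × Bool))
    (t : ℕ) : List (A × Bool) × List (A × Bool) :=
  -- Indices `0` and `1` are the two directions of the inverse law, and `2` is the commutation law,
  -- reversed by swapping the parameters. From `3` on come the rules of `Q`; an index out of range
  -- gives the trivial rule, so every index is sound.
  ((w.1 ++ FreeGroup.invRev w.1 ++ w.1, w.1) :: (w.1, w.1 ++ FreeGroup.invRev w.1 ++ w.1) ::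
    (w.1 ++ FreeGroup.invRev w.1 ++ (w.2 ++ FreeGroup.invRev w.2),
      w.2 ++ FreeGroup.invRev w.2 ++ (w.1 ++ FreeGroup.invRev w.1)) :: Q).getD t ([], [])

/-- Data of one rewriting step: the context, the parameters of the rule, and its index. -/
abbrev Instr (A : Type u) : Type u :=
  (List (A × Bool) × List (A × Bool)) × (List (A × Bool) × List (A × Bool)) × ℕ

/-- Perform one rewriting step, if it applies. -/
def rewrite [DecidableEq A] (Q : List (List (A × Bool) × List (A × Bool))) (x : List (A × Bool)) (s : Instr A) :
    List (A × Bool) :=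
  -- An inapplicable instruction leaves the word unchanged, so every list of instructions is a valid
  -- derivation.
  if x = s.1.1 ++ (rule Q s.2.1 s.2.2).1 ++ s.1.2 then
    s.1.1 ++ (rule Q s.2.1 s.2.2).2 ++ s.1.2 else x

theorem primrec_rewrite [DecidableEq A] [Finite A] [Primcodable A]
    (Q : List (List (A × Bool) × List (A × Bool))) : Primrec₂ (rewrite Q) := by
  have h1 : Primrec fun p : List (A × Bool) × Instr A => p.2.2.1.1 :=
    Primrec.fst.comp (Primrec.fst.comp (Primrec.snd.comp Primrec.snd))
  have h2 : Primrec fun p : List (A × Bool) × Instr A => p.2.2.1.2 :=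
    Primrec.snd.comp (Primrec.fst.comp (Primrec.snd.comp Primrec.snd))
  have e1 := Primrec.list_append.comp h1 (primrec_wordInv h1)
  have e2 := Primrec.list_append.comp h2 (primrec_wordInv h2)
  have e3 := Primrec.list_append.comp e1 h1
  have hr : Primrec fun p : List (A × Bool) × Instr A => rule Q p.2.2.1 p.2.2.2 :=
    (Primrec.list_getD _).comp
      (Primrec.list_cons.comp (e3.pair h1) (Primrec.list_cons.comp (h1.pair e3)
        (Primrec.list_cons.comp ((Primrec.list_append.comp e1 e2).pair
          (Primrec.list_append.comp e2 e1)) (Primrec.const Q))))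
      (Primrec.snd.comp (Primrec.snd.comp Primrec.snd))
  have l1 : Primrec fun p : List (A × Bool) × Instr A => p.2.1.1 :=
    Primrec.fst.comp (Primrec.fst.comp Primrec.snd)
  have l2 : Primrec fun p : List (A × Bool) × Instr A => p.2.1.2 :=
    Primrec.snd.comp (Primrec.fst.comp Primrec.snd)
  have c1 := Primrec.list_append.comp (Primrec.list_append.comp l1 (Primrec.fst.comp hr)) l2
  have c2 := Primrec.list_append.comp (Primrec.list_append.comp l1 (Primrec.snd.comp hr)) l2
  exact Primrec.ite (Primrec.eq.comp Primrec.fst c1) c2 Primrec.fst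

theorem presCon_rule {R : Set (Word A × Word A)} {Q : List (List (A × Bool) × List (A × Bool))}
    (hQ : ∀ r ∈ Q, presCon R (FreeMonoid.ofList r.1) (FreeMonoid.ofList r.2))
    (w : List (A × Bool) × List (A × Bool)) (t : ℕ) :
    presCon R (FreeMonoid.ofList (rule Q w t).1) (FreeMonoid.ofList (rule Q w t).2) := by
  match t with
  | 0 => exact presCon_of_vagner R (.inv_law (FreeMonoid.ofList w.1))
  | 1 => exact (presCon R).symm (presCon_of_vagner R (.inv_law (FreeMonoid.ofList w.1)))
  | 2 => exact presCon_of_vagner R (.comm_law (FreeMonoid.ofList w.1) (FreeMonoid.ofList w.2))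
  | t + 3 =>
    simp only [rule, List.getD_cons_succ]
    by_cases ht : t < Q.length
    · rw [List.getD_eq_getElem _ _ ht]
      exact hQ _ (List.getElem_mem ht)
    · rw [List.getD_eq_default _ _ (not_lt.1 ht)]
      exact (presCon R).refl _

theorem presCon_rewrite [DecidableEq A] {R : Set (Word A × Word A)}
    {Q : List (List (A × Bool) × List (A × Bool))}
    (hQ : ∀ r ∈ Q, presCon R (FreeMonoid.ofList r.1) (FreeMonoid.ofList r.2))
    (x : List (A × Bool)) (s : Instr A) :
    presCon R (FreeMonoid.ofList x) (FreeMonoid.ofList (rewrite Q x s)) := by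
  unfold rewrite
  split_ifs with h
  · conv_lhs => rw [h]
    exact (presCon R).mul ((presCon R).mul ((presCon R).refl _) (presCon_rule hQ _ _))
      ((presCon R).refl _)
  · exact (presCon R).refl _

theorem rewrite_eq [DecidableEq A] (Q : List (List (A × Bool) × List (A × Bool)))
    (p q : List (A × Bool)) (w : List (A × Bool) × List (A × Bool)) (t : ℕ) :
    rewrite Q (p ++ (rule Q w t).1 ++ q) ((p, q), w, t) = p ++ (rule Q w t).2 ++ q := by
  simp [rewrite]

theorem exists_rule_swap {Q : List (List (A × Bool) × List (A × Bool))}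
    (hQ : ∀ r ∈ Q, r.swap ∈ Q) (w : List (A × Bool) × List (A × Bool)) (t : ℕ) :
    ∃ w' t', rule Q w' t' = (rule Q w t).swap := by
  match t with
  | 0 => exact ⟨w, 1, rfl⟩
  | 1 => exact ⟨w, 0, rfl⟩
  | 2 => exact ⟨w.swap, 2, rfl⟩
  | t + 3 =>
    by_cases ht : t < Q.length
    · obtain ⟨j, hj, e⟩ := List.getElem_of_mem (hQ _ (List.getElem_mem ht))
      refine ⟨w, j + 3, ?_⟩
      simp only [rule, List.getD_cons_succ]
      rw [List.getD_eq_getElem _ _ ht, List.getD_eq_getElem _ _ hj, e]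
    · refine ⟨w, t + 3, ?_⟩
      simp only [rule, List.getD_cons_succ]
      rw [List.getD_eq_default _ _ (not_lt.1 ht)]
      rfl

theorem rewrite_cases [DecidableEq A] (Q : List (List (A × Bool) × List (A × Bool))) (x : List (A × Bool))
    (s : Instr A) : rewrite Q x s = x ∨ ∃ p q w t, x = p ++ (rule Q w t).1 ++ q ∧
      rewrite Q x s = p ++ (rule Q w t).2 ++ q := by
  by_cases h : x = s.1.1 ++ (rule Q s.2.1 s.2.2).1 ++ s.1.2
  · exact Or.inr ⟨_, _, _, _, h, if_pos h⟩
  · exact Or.inl (if_neg h)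

/-- A step is undone by applying the swapped rule in the same context; a step that did nothing needs
no undoing. -/
theorem exists_rewrite_symm [DecidableEq A] {Q : List (List (A × Bool) × List (A × Bool))}
    (hQ : ∀ r ∈ Q, r.swap ∈ Q) (x : List (A × Bool)) (s : Instr A) :
    ∃ l, List.foldl (rewrite Q) (rewrite Q x s) l = x := by
  rcases rewrite_cases Q x s with h | ⟨p, q, w, t, h1, h2⟩
  · exact ⟨[], h⟩
  · obtain ⟨w', t', e⟩ := exists_rule_swap hQ w t
    have e1 : (rule Q w t).2 = (rule Q w' t').1 := by rw [e]; rfl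
    have e2 : (rule Q w t).1 = (rule Q w' t').2 := by rw [e]; rfl
    refine ⟨[((p, q), w', t')], ?_⟩
    rw [h2, h1, e1, e2]
    exact rewrite_eq Q p q w' t'

theorem exists_rewrite_context [DecidableEq A] (Q : List (List (A × Bool) × List (A × Bool)))
    (a b x : List (A × Bool)) (s : Instr A) :
    ∃ l, List.foldl (rewrite Q) (a ++ x ++ b) l = a ++ rewrite Q x s ++ b := by
  rcases rewrite_cases Q x s with h | ⟨p, q, w, t, h1, h2⟩
  · exact ⟨[], by rw [h]; rfl⟩
  · refine ⟨[((a ++ p, q ++ b), w, t)], ?_⟩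
    rw [h2, h1, List.foldl_cons, List.foldl_nil]
    simpa only [List.append_assoc] using rewrite_eq Q (a ++ p) (q ++ b) w t

theorem exists_foldl_rewrite_symm [DecidableEq A] {Q : List (List (A × Bool) × List (A × Bool))}
    (hQ : ∀ r ∈ Q, r.swap ∈ Q) (l : List (Instr A)) (x : List (A × Bool)) :
    ∃ l', List.foldl (rewrite Q) (List.foldl (rewrite Q) x l) l' = x := by
  induction l generalizing x with
  | nil => exact ⟨[], rfl⟩
  | cons s l ih =>
    obtain ⟨l', h'⟩ := ih (rewrite Q x s)
    obtain ⟨m, hm⟩ := exists_rewrite_symm hQ x s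
    exact ⟨l' ++ m, by rw [List.foldl_append, List.foldl_cons, h', hm]⟩

theorem exists_foldl_rewrite_context [DecidableEq A] (Q : List (List (A × Bool) × List (A × Bool)))
    (a b : List (A × Bool)) (l : List (Instr A)) (x : List (A × Bool)) :
    ∃ l', List.foldl (rewrite Q) (a ++ x ++ b) l' = a ++ List.foldl (rewrite Q) x l ++ b := by
  induction l generalizing x with
  | nil => exact ⟨[], rfl⟩
  | cons s l ih =>
    obtain ⟨l', h'⟩ := ih (rewrite Q x s)
    obtain ⟨m, hm⟩ := exists_rewrite_context Q a b x s
    exact ⟨m ++ l', by rw [List.foldl_append, hm, h', List.foldl_cons]⟩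

/-- Derivability by the rewriting rules, as a congruence. -/
def derivCon [DecidableEq A] (Q : List (List (A × Bool) × List (A × Bool))) (hQ : ∀ r ∈ Q, r.swap ∈ Q) :
    Con (Word A) where
  r x y := ∃ l, List.foldl (rewrite Q) (FreeMonoid.toList x) l = FreeMonoid.toList y
  iseqv := by
    refine ⟨fun x => ⟨[], rfl⟩, ?_, ?_⟩
    · rintro x y ⟨l, h⟩
      rw [← h]
      exact exists_foldl_rewrite_symm hQ l _
    · rintro x y z ⟨l, h⟩ ⟨m, h'⟩
      exact ⟨l ++ m, by rw [List.foldl_append, h, h']⟩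
  mul' := by
    rintro w x y z ⟨l, h⟩ ⟨m, h'⟩
    obtain ⟨l', e⟩ := exists_foldl_rewrite_context Q [] (FreeMonoid.toList y) l
      (FreeMonoid.toList w)
    obtain ⟨m', e'⟩ := exists_foldl_rewrite_context Q (FreeMonoid.toList x) [] m
      (FreeMonoid.toList y)
    rw [h, List.nil_append, List.nil_append] at e
    rw [h', List.append_nil, List.append_nil] at e'
    refine ⟨l' ++ m', ?_⟩
    rw [List.foldl_append, FreeMonoid.toList_mul, FreeMonoid.toList_mul, e, e']

theorem derivCon_rule [DecidableEq A] {Q : List (List (A × Bool) × List (A × Bool))} (hQ : ∀ r ∈ Q, r.swap ∈ Q)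
    (w : List (A × Bool) × List (A × Bool)) (t : ℕ) :
    derivCon Q hQ (FreeMonoid.ofList (rule Q w t).1) (FreeMonoid.ofList (rule Q w t).2) := by
  refine ⟨[(([], []), w, t)], ?_⟩
  simpa using rewrite_eq Q [] [] w t

theorem exists_list_of_finite {R : Set (Word A × Word A)} (hR : R.Finite) :
    ∃ Q : List (List (A × Bool) × List (A × Bool)), ∀ x y : List (A × Bool),
      (x, y) ∈ Q ↔ (FreeMonoid.ofList x, FreeMonoid.ofList y) ∈ R := by
  refine ⟨hR.toFinset.toList.map fun r => (FreeMonoid.toList r.1, FreeMonoid.toList r.2),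
    fun x y => ?_⟩
  simp only [List.mem_map, Finset.mem_toList, Set.Finite.mem_toFinset, Prod.mk.injEq]
  constructor
  · rintro ⟨r, hr, rfl, rfl⟩
    exact hr
  · exact fun h => ⟨_, h, rfl, rfl⟩

/-- Equality in `Inv⟨A | R⟩` is witnessed by sequences of rewriting steps. -/
theorem exists_presCon_iff_foldl [DecidableEq A] {R : Set (Word A × Word A)} (hR : R.Finite) :
    ∃ Q : List (List (A × Bool) × List (A × Bool)), ∀ x y : List (A × Bool),
      presCon R (FreeMonoid.ofList x) (FreeMonoid.ofList y) ↔
        ∃ l, List.foldl (rewrite Q) x l = y := by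
  obtain ⟨Q₀, hQ₀⟩ := exists_list_of_finite hR
  -- The rules are symmetrised so that derivability is an equivalence relation.
  have hm : ∀ x y, (x, y) ∈ Q₀ ++ Q₀.map Prod.swap ↔
      (FreeMonoid.ofList x, FreeMonoid.ofList y) ∈ R ∨
      (FreeMonoid.ofList y, FreeMonoid.ofList x) ∈ R := by
    intro x y
    rw [← hQ₀, ← hQ₀, List.mem_append, List.mem_map]
    refine or_congr Iff.rfl ⟨?_, fun h => ⟨_, h, rfl⟩⟩
    rintro ⟨⟨a, b⟩, h, e⟩
    cases e
    exact h
  generalize Q₀ ++ Q₀.map Prod.swap = Q at hm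
  have hQ : ∀ r ∈ Q, r.swap ∈ Q := by
    rintro ⟨x, y⟩ h
    exact (hm _ _).2 ((hm _ _).1 h).symm
  have hs : ∀ r ∈ Q, presCon R (FreeMonoid.ofList r.1) (FreeMonoid.ofList r.2) := by
    rintro ⟨x, y⟩ h
    rcases (hm _ _).1 h with h | h
    · exact presCon_of_mem h
    · exact (presCon R).symm (presCon_of_mem h)
  refine ⟨Q, fun x y => ⟨fun h => ?_, ?_⟩⟩
  · have : presCon R ≤ derivCon _ hQ := by
      refine presCon_le ?_ ?_
      · rintro x y (w | ⟨x, y⟩)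
        · exact derivCon_rule hQ (FreeMonoid.toList y, []) 0
        · exact derivCon_rule hQ (FreeMonoid.toList x, FreeMonoid.toList y) 2
      · intro x y h
        obtain ⟨j, hj, e⟩ := List.getElem_of_mem ((hm (FreeMonoid.toList x) (FreeMonoid.toList y)).2 (Or.inl h))
        have := derivCon_rule hQ ([], []) (j + 3)
        have h' : rule Q ([], []) (j + 3) = (FreeMonoid.toList x, FreeMonoid.toList y) := by
          simp only [rule, List.getD_cons_succ]
          rw [List.getD_eq_getElem _ _ hj, e]
        rw [h'] at this
        exact this
    exact this h
  · rintro ⟨l, rfl⟩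
    induction l using List.reverseRecOn with
    | nil => exact (presCon R).refl _
    | append_singleton l s ih =>
      rw [List.foldl_append]
      exact (presCon R).trans ih (presCon_rewrite hs _ _)

end Derivation

/-! ### Finite models coded as tables -/

section Table

/-- A finite table: a bound, a binary operation, a unary operation, a constant, the values of the
letters, and a marking of some elements. -/
abbrev Table : Type := ℕ × List (List ℕ) × List ℕ × ℕ × List ℕ × List ℕ

namespace Table

/-- The number of elements of a table. -/
def size (c : Table) : ℕ := c.1 + 1

/-- The binary operation of a table. -/
def op (c : Table) (x y : ℕ) : ℕ := ((c.2.1.getD x []).getD y 0) % c.size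

/-- The unary operation of a table. -/
def inv (c : Table) (x : ℕ) : ℕ := (c.2.2.1.getD x 0) % c.size

/-- The constant of a table. -/
def unit (c : Table) : ℕ := c.2.2.2.1 % c.size

/-- The value of a letter in a table. -/
def letter {L : Type*} [Encodable L] (c : Table) (l : L) : ℕ :=
  (c.2.2.2.2.1.getD (Encodable.encode l) 0) % c.size

/-- The value of a word in a table. -/
def eval {L : Type*} [Encodable L] (c : Table) (w : List L) : ℕ :=
  w.foldl (fun q l => c.op q (c.letter l)) c.unit

/-- The marking of a table. -/
def Marked (c : Table) (x : ℕ) : Prop := c.2.2.2.2.2.getD x 0 = 1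

theorem primrec_size : Primrec size := Primrec.succ.comp Primrec.fst

variable {α : Type*} [Primcodable α] {c : α → Table} {f g : α → ℕ}

theorem primrec_op (hc : Primrec c) (hf : Primrec f) (hg : Primrec g) :
    Primrec fun a => (c a).op (f a) (g a) :=
  Primrec.nat_mod.comp ((Primrec.list_getD 0).comp ((Primrec.list_getD []).comp
    (Primrec.fst.comp (Primrec.snd.comp hc)) hf) hg) (primrec_size.comp hc)

theorem primrec_inv (hc : Primrec c) (hf : Primrec f) : Primrec fun a => (c a).inv (f a) :=
  Primrec.nat_mod.comp ((Primrec.list_getD 0).comp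
    (Primrec.fst.comp (Primrec.snd.comp (Primrec.snd.comp hc))) hf) (primrec_size.comp hc)

theorem primrec_unit (hc : Primrec c) : Primrec fun a => (c a).unit :=
  Primrec.nat_mod.comp (Primrec.fst.comp (Primrec.snd.comp (Primrec.snd.comp (Primrec.snd.comp hc))))
    (primrec_size.comp hc)

theorem primrec_letter {L : Type*} [Primcodable L] (hc : Primrec c) {l : α → L} (hl : Primrec l) :
    Primrec fun a => (c a).letter (l a) :=
  Primrec.nat_mod.comp ((Primrec.list_getD 0).comp
    (Primrec.fst.comp (Primrec.snd.comp (Primrec.snd.comp (Primrec.snd.comp (Primrec.snd.comp hc)))))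
    (Primrec.encode.comp hl)) (primrec_size.comp hc)

theorem primrec_eval {L : Type*} [Primcodable L] (hc : Primrec c) {w : α → List L}
    (hw : Primrec w) : Primrec fun a => (c a).eval (w a) :=
  Primrec.list_foldl hw (primrec_unit hc)
    (primrec_op (hc.comp Primrec.fst) (Primrec.fst.comp Primrec.snd)
      (primrec_letter (hc.comp Primrec.fst) (Primrec.snd.comp Primrec.snd))).to₂

theorem primrecPred_marked (hc : Primrec c) (hf : Primrec f) :
    PrimrecPred fun a => (c a).Marked (f a) :=
  Primrec.eq.comp ((Primrec.list_getD 0).comp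
    (Primrec.snd.comp (Primrec.snd.comp (Primrec.snd.comp (Primrec.snd.comp (Primrec.snd.comp hc)))))
    hf) (Primrec.const 1)

/-- The laws of a monoid with inverse operation, at three elements. -/
def Laws (c : Table) (x y z : ℕ) : Prop :=
  c.op (c.op x y) z = c.op x (c.op y z) ∧ c.op c.unit x = x ∧ c.op x c.unit = x ∧
    c.op (c.op x (c.inv x)) x = x ∧
    c.op (c.op x (c.inv x)) (c.op y (c.inv y)) = c.op (c.op y (c.inv y)) (c.op x (c.inv x)) ∧
    c.inv (c.op x y) = c.op (c.inv y) (c.inv x)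

theorem primrecPred_laws {h : α → ℕ} (hc : Primrec c) (hf : Primrec f) (hg : Primrec g)
    (hh : Primrec h) : PrimrecPred fun a => (c a).Laws (f a) (g a) (h a) := by
  have e1 := primrec_op hc hf (primrec_inv hc hf)
  have e2 := primrec_op hc hg (primrec_inv hc hg)
  refine PrimrecPred.and (Primrec.eq.comp (primrec_op hc (primrec_op hc hf hg) hh)
    (primrec_op hc hf (primrec_op hc hg hh))) (PrimrecPred.and (Primrec.eq.comp
    (primrec_op hc (primrec_unit hc) hf) hf) (PrimrecPred.and (Primrec.eq.comp
    (primrec_op hc hf (primrec_unit hc)) hf) (PrimrecPred.and (Primrec.eq.comp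
    (primrec_op hc e1 hf) hf) (PrimrecPred.and (Primrec.eq.comp (primrec_op hc e1 e2)
    (primrec_op hc e2 e1)) (Primrec.eq.comp (primrec_inv hc (primrec_op hc hf hg))
    (primrec_op hc (primrec_inv hc hg) (primrec_inv hc hf)))))))

theorem primrecPred_forall_lt {β : Type*} [Primcodable β] {p : β × ℕ → Prop} (hp : PrimrecPred p)
    {n : β → ℕ} (hn : Primrec n) : PrimrecPred fun b => ∀ x < n b, p (b, x) := by
  have : PrimrecRel fun (x : ℕ) (b : β) => p (b, x) := hp.comp (Primrec.snd.pair Primrec.fst)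
  have h := this.forall_mem_list
  exact (h.comp (Primrec.list_range.comp hn) Primrec.id).of_eq fun b => by simp

theorem primrecPred_forall_mem {β γ : Type*} [Primcodable β] [Primcodable γ] {p : β × γ → Prop}
    (hp : PrimrecPred p) (l : List γ) : PrimrecPred fun b => ∀ x ∈ l, p (b, x) := by
  have : PrimrecRel fun (x : γ) (b : β) => p (b, x) := hp.comp (Primrec.snd.pair Primrec.fst)
  have h := this.forall_mem_list
  exact h.comp (Primrec.const l) Primrec.id

variable {A : Type u}

/-- A table is a model when it is a monoid with a compatible inverse operation satisfying the
relations in `Q`. -/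
def IsModel [Encodable A] (L : List (A × Bool)) (Q : List (List (A × Bool) × List (A × Bool))) (c : Table) :
    Prop :=
  (∀ x < c.size, ∀ y < c.size, ∀ z < c.size, c.Laws x y z) ∧
    (∀ l ∈ L, c.inv (c.letter l) = c.letter (l.1, !l.2)) ∧ ∀ r ∈ Q, c.eval r.1 = c.eval r.2

/-- The marked elements of a table contain the identity and are closed under right multiplication
by the values of the words in `G`. -/
def IsClosed [Encodable A] (G : List (List (A × Bool))) (c : Table) : Prop :=
  c.Marked c.unit ∧ ∀ x < c.size, ∀ w ∈ G, c.Marked x → c.Marked (c.op x (c.eval w))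

theorem primrecPred_isModel [Finite A] [Primcodable A] (L : List (A × Bool))
    (Q : List (List (A × Bool) × List (A × Bool))) : PrimrecPred (IsModel L Q) := by
  refine PrimrecPred.and ?_ (PrimrecPred.and ?_ ?_)
  · have h1 : PrimrecPred fun a : ((Table × ℕ) × ℕ) × ℕ => Laws a.1.1.1 a.1.1.2 a.1.2 a.2 :=
      primrecPred_laws (Primrec.fst.comp (Primrec.fst.comp Primrec.fst))
        (Primrec.snd.comp (Primrec.fst.comp Primrec.fst)) (Primrec.snd.comp Primrec.fst) Primrec.snd
    have h2 := primrecPred_forall_lt h1 (primrec_size.comp (Primrec.fst.comp Primrec.fst))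
    have h3 := primrecPred_forall_lt h2 (primrec_size.comp Primrec.fst)
    exact primrecPred_forall_lt h3 primrec_size
  · refine primrecPred_forall_mem (p := fun a : Table × (A × Bool) =>
      a.1.inv (a.1.letter a.2) = a.1.letter (a.2.1, !a.2.2)) ?_ L
    exact Primrec.eq.comp (primrec_inv Primrec.fst (primrec_letter Primrec.fst Primrec.snd))
      (primrec_letter Primrec.fst
        ((Primrec.dom_finite fun l : A × Bool => (l.1, !l.2)).comp Primrec.snd))
  · refine primrecPred_forall_mem (p := fun a : Table × (List (A × Bool) × List (A × Bool)) =>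
      a.1.eval a.2.1 = a.1.eval a.2.2) ?_ Q
    exact Primrec.eq.comp (primrec_eval Primrec.fst (Primrec.fst.comp Primrec.snd))
      (primrec_eval Primrec.fst (Primrec.snd.comp Primrec.snd))

theorem primrecPred_isClosed [Primcodable A] (G : List (List (A × Bool))) :
    PrimrecPred (IsClosed G) := by
  refine PrimrecPred.and (primrecPred_marked Primrec.id (primrec_unit Primrec.id)) ?_
  refine primrecPred_forall_lt (primrecPred_forall_mem (p := fun a =>
    Marked a.1.1 a.1.2 → Marked a.1.1 (op a.1.1 a.1.2 (eval a.1.1 a.2))) ?_ G) primrec_size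
  have h1 : Primrec fun a : (Table × ℕ) × List (A × Bool) => a.1.1 :=
    Primrec.fst.comp Primrec.fst
  have h2 : Primrec fun a : (Table × ℕ) × List (A × Bool) => a.1.2 :=
    Primrec.snd.comp Primrec.fst
  refine ((primrecPred_marked h1 h2).not.or (primrecPred_marked h1
    (primrec_op h1 h2 (primrec_eval h1 Primrec.snd)))).of_eq fun a => ?_
  exact imp_iff_not_or.symm

theorem size_pos (c : Table) : 0 < c.size := Nat.succ_pos _

/-- Reduction modulo the size makes even a malformed table define operations on `Fin c.size`, so no
well-formedness test enters the search. -/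
theorem op_lt (c : Table) (x y : ℕ) : c.op x y < c.size := Nat.mod_lt _ c.size_pos

theorem inv_lt (c : Table) (x : ℕ) : c.inv x < c.size := Nat.mod_lt _ c.size_pos

theorem unit_lt (c : Table) : c.unit < c.size := Nat.mod_lt _ c.size_pos

theorem letter_lt {L : Type*} [Encodable L] (c : Table) (l : L) : c.letter l < c.size :=
  Nat.mod_lt _ c.size_pos

/-- Elements of a table. -/
def Carrier (c : Table) : Type := Fin c.size

/-- The monoid given by a table satisfying the laws. -/
abbrev toMonoid (c : Table)
    (h : ∀ x < c.size, ∀ y < c.size, ∀ z < c.size, c.Laws x y z) : Monoid c.Carrier where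
  mul x y := ⟨c.op x.1 y.1, c.op_lt _ _⟩
  one := ⟨c.unit, c.unit_lt⟩
  mul_assoc x y z := Fin.ext (h x.1 x.2 y.1 y.2 z.1 z.2).1
  one_mul x := Fin.ext (h x.1 x.2 x.1 x.2 x.1 x.2).2.1
  mul_one x := Fin.ext (h x.1 x.2 x.1 x.2 x.1 x.2).2.2.1

/-- A model yields a homomorphism that respects the presentation. -/
theorem IsModel.exists_hom [Encodable A] {L : List (A × Bool)} (hL : ∀ l, l ∈ L)
    {Q : List (List (A × Bool) × List (A × Bool))} {c : Table} (h : IsModel L Q c)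
    {R : Set (Word A × Word A)}
    (hQ : ∀ x y, (x, y) ∈ R → (FreeMonoid.toList x, FreeMonoid.toList y) ∈ Q) :
    (∀ x y, presCon R x y → c.eval (FreeMonoid.toList x) = c.eval (FreeMonoid.toList y)) ∧
    (∀ x y : List (A × Bool), c.eval (x ++ y) = c.op (c.eval x) (c.eval y)) := by
  let _ := c.toMonoid h.1
  let φ : Word A →* c.Carrier := FreeMonoid.lift fun l => (⟨c.letter l, c.letter_lt l⟩ : Fin c.size)
  have hφ : ∀ w : List (A × Bool), (φ (FreeMonoid.ofList w)).1 = c.eval w := by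
    intro w
    induction w using List.reverseRecOn with
    | nil => rfl
    | append_singleton w l ih =>
      rw [eval, List.foldl_append, FreeMonoid.ofList_append, map_mul]
      change c.op (φ (FreeMonoid.ofList w)).1 (φ (FreeMonoid.of l)).1 = _
      rw [ih]
      rfl
  have key : presCon R ≤ Con.ker φ := by
    refine presCon_le_ker_of_inv φ (fun x => (⟨c.inv x.1, c.inv_lt _⟩ : Fin c.size)) ?_ ?_ ?_ ?_ ?_
    · exact fun x => Fin.ext (h.1 x.1 x.2 x.1 x.2 x.1 x.2).2.2.2.1
    · exact fun x y => Fin.ext (h.1 x.1 x.2 y.1 y.2 x.1 x.2).2.2.2.2.1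
    · exact fun x y => Fin.ext (h.1 x.1 x.2 y.1 y.2 x.1 x.2).2.2.2.2.2
    · exact fun l => Fin.ext (h.2.1 l (hL l))
    · intro x y hxy
      refine Fin.ext ?_
      have := h.2.2 _ (hQ x y hxy)
      rw [← hφ, ← hφ] at this
      exact this
  refine ⟨fun x y hxy => ?_, fun x y => ?_⟩
  · rw [← hφ, ← hφ]
    exact congrArg Fin.val (key hxy)
  · rw [← hφ, ← hφ, ← hφ, FreeMonoid.ofList_append, map_mul]
    rfl

/-- Every finite quotient is described by a table. -/
theorem exists_table [Encodable A] [Finite A] {T : Type*} [Monoid T] [Finite T] (φ : Word A →* T)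
    (i : T → T) (m : T → Prop) :
    ∃ (c : Table) (e : T → ℕ), (∀ x < c.size, ∃ t, e t = x) ∧ Function.Injective e ∧
      (∀ t, e t < c.size) ∧ (∀ s t, c.op (e s) (e t) = e (s * t)) ∧ (∀ t, c.inv (e t) = e (i t)) ∧
      c.unit = e 1 ∧ (∀ l, c.letter l = e (φ (FreeMonoid.of l))) ∧ ∀ t, c.Marked (e t) ↔ m t := by
  classical
  obtain ⟨n, ⟨e⟩⟩ := Finite.exists_equiv_fin T
  -- A monoid is nonempty, which matches the convention that a table has one element more than its
  -- first entry.
  obtain ⟨n, rfl⟩ : ∃ k, n = k + 1 := Nat.exists_eq_succ_of_ne_zero fun h => by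
    subst h; exact (e 1).elim0
  let d : ℕ → T := fun k => e.symm (Fin.ofNat (n + 1) k)
  have hd : ∀ t, d (e t).1 = t := fun t => by simp [d]
  have hm : ∀ t, (e t).1 % (n + 1) = (e t).1 := fun t => Nat.mod_eq_of_lt (e t).2
  choose row hrow using fun k => exists_list_getD (n + 1) 0 fun j => (e (d k * d j)).1
  obtain ⟨t1, h1⟩ := exists_list_getD (n + 1) [] row
  obtain ⟨t2, h2⟩ := exists_list_getD (n + 1) 0 fun k => (e (i (d k))).1
  obtain ⟨t3, h3⟩ := exists_list_getD_encode fun l : A × Bool => (e (φ (FreeMonoid.of l))).1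
  obtain ⟨t4, h4⟩ := exists_list_getD (n + 1) 0 fun k => if m (d k) then 1 else 0
  refine ⟨(n, t1, t2, (e 1).1, t3, t4), fun t => (e t).1, ?_, ?_, ?_, ?_, ?_, ?_, ?_, ?_⟩
  · exact fun x hx => ⟨e.symm ⟨x, hx⟩, by simp⟩
  · exact fun s t h => e.injective (Fin.ext h)
  · exact fun t => (e t).2
  · intro s t
    simp only [op, size, h1 _ (e s).2, hrow _ _ (e t).2, hd, hm]
  · intro t
    simp only [inv, size, h2 _ (e t).2, hd, hm]
  · exact hm 1
  · intro l
    simp only [letter, size, h3, hm]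
  · intro t
    simp only [Marked, h4 _ (e t).2, hd]
    split_ifs with h <;> simp [h]

/-- Finite quotients satisfying the relations give models. -/
theorem exists_isModel [Encodable A] [Finite A] {T : Type*} [Monoid T] [Finite T] (φ : Word A →* T)
    (hs : Function.Surjective φ) {R : Set (Word A × Word A)} (hR : presCon R ≤ Con.ker φ)
    (L : List (A × Bool)) {Q : List (List (A × Bool) × List (A × Bool))}
    (hQ : ∀ x y, (x, y) ∈ Q → (FreeMonoid.ofList x, FreeMonoid.ofList y) ∈ R)
    {G : List (List (A × Bool))} (S : Submonoid T) (hG : ∀ w ∈ G, φ (FreeMonoid.ofList w) ∈ S) :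
    ∃ c : Table, c.IsModel L Q ∧ c.IsClosed G ∧
      ∀ w : List (A × Bool), c.Marked (c.eval w) ↔ φ (FreeMonoid.ofList w) ∈ S := by
  -- Surjectivity of `φ` supplies the inverse operation that the table has to record.
  obtain ⟨i, i1, i2, i3, i4⟩ := exists_inv_of_surjective φ hs
    fun x y h => hR (presCon_of_vagner R h)
  obtain ⟨c, e, hsurj, hinj, hlt, hop, hinv, hunit, hletter, hmark⟩ :=
    exists_table φ i (· ∈ S)
  have hev : ∀ w : List (A × Bool), c.eval w = e (φ (FreeMonoid.ofList w)) := by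
    intro w
    induction w using List.reverseRecOn with
    | nil => exact hunit.trans (by rw [FreeMonoid.ofList_nil, map_one])
    | append_singleton w l ih =>
      have : c.eval (w ++ [l]) = c.op (c.eval w) (c.letter l) := by
        rw [eval, List.foldl_append]; rfl
      rw [this, ih, hletter, hop, FreeMonoid.ofList_append, map_mul, FreeMonoid.ofList_singleton]
  refine ⟨c, ⟨?_, ?_, ?_⟩, ⟨?_, ?_⟩, ?_⟩
  · intro x hx y hy z hz
    obtain ⟨x, rfl⟩ := hsurj x hx
    obtain ⟨y, rfl⟩ := hsurj y hy
    obtain ⟨z, rfl⟩ := hsurj z hz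
    simp only [Laws, hop, hinv, hunit, mul_assoc, one_mul, mul_one, i3, true_and, and_true]
    refine ⟨?_, ?_⟩
    · rw [← mul_assoc, i1]
    · have := i2 x y
      simp only [mul_assoc] at this
      rw [this]
  · intro l _
    rw [hletter, hinv, hletter, i4]
  · rintro ⟨x, y⟩ h
    rw [hev, hev]
    exact congrArg e (hR (presCon_of_mem (hQ x y h)))
  · rw [hunit, hmark]
    exact S.one_mem
  · intro x hx w hw
    obtain ⟨x, rfl⟩ := hsurj x hx
    rw [hev, hop, hmark, hmark]
    exact fun h => S.mul_mem h (hG w hw)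
  · intro w
    rw [hev, hmark]

end Table
end Table

/-! ### Membership in a single finitely presented monoid -/

/-- The membership problem is decidable for finitely generated submonoids of finitely presented
finite-J-above inverse monoids. -/
theorem decidableMembership_range {B : Type u} [Finite B] {R : Set (Word B × Word B)}
    (hR : R.Finite) (hJ : FiniteJAbove (Presented R)) {Γ : Type u} [Finite Γ]
    (ψ : FreeMonoid Γ →* Presented R) :
    DecidableMembership (Presented R) (Set.range ψ) := by
  classical
  intro k g
  obtain ⟨_⟩ := exists_primcodable_of_finite B
  obtain ⟨_⟩ := exists_primcodable_of_finite Γ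
  obtain ⟨Ψ, hΨ⟩ := exists_lift ψ
  choose u hu using fun j => Con.mk'_surjective (c := presCon R) (g j)
  let U : List (Fin k) → List (B × Bool) := fun w => w.flatMap fun j => FreeMonoid.toList (u j)
  have hU : ∀ w, (w.map g).prod = (presCon R).mk' (FreeMonoid.ofList (U w)) := by
    intro w
    induction w with
    | nil => rfl
    | cons j w ih =>
      rw [List.map_cons, List.prod_cons, ih, ← hu, ← map_mul]
      rfl
  let V : List Γ → List (B × Bool) := fun w => w.flatMap fun j => FreeMonoid.toList (Ψ j)
  have hV : ∀ w, FreeMonoid.lift Ψ (FreeMonoid.ofList w) = FreeMonoid.ofList (V w) := by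
    intro w
    induction w with
    | nil => rfl
    | cons j w ih =>
      rw [FreeMonoid.ofList_cons, map_mul, ih]
      rfl
  have hpU : Primrec U := primrec_flatMap_const Primrec.id _
  have hpV : Primrec V := primrec_flatMap_const Primrec.id _
  have hmem : ∀ w, (w.map g).prod ∈ Set.range ψ ↔
      ∃ x : List Γ, presCon R (FreeMonoid.ofList (V x)) (FreeMonoid.ofList (U w)) := by
    intro w
    constructor
    · rintro ⟨x, hx⟩
      refine ⟨FreeMonoid.toList x, ?_⟩
      rw [hΨ, hU] at hx
      rw [← hV]
      exact (Con.eq _).1 hx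
    · rintro ⟨x, hx⟩
      refine ⟨FreeMonoid.ofList x, ?_⟩
      rw [hΨ, hU, hV]
      exact (Con.eq _).2 hx
  rw [ComputablePred.computable_iff_re_compl_re]
  constructor
  -- Membership: search for a word over `Γ` and a derivation from its value to the given word.
  · obtain ⟨Q, hQ⟩ := exists_presCon_iff_foldl hR
    have : PrimrecPred fun a : List (Fin k) × (List Γ × List (Instr B)) =>
        List.foldl (rewrite Q) (V a.2.1) a.2.2 = U a.1 := by
      have hs : Primrec₂ fun (_ : List (Fin k) × (List Γ × List (Instr B)))
          (p : List (B × Bool) × Instr B) => rewrite Q p.1 p.2 :=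
        (primrec_rewrite Q).comp (Primrec.fst.comp Primrec.snd) (Primrec.snd.comp Primrec.snd)
      exact Primrec.eq.comp (Primrec.list_foldl (Primrec.snd.comp Primrec.snd)
        (hpV.comp (Primrec.fst.comp Primrec.snd)) hs) (hpU.comp Primrec.fst)
    refine (rePred_exists this).of_eq fun w => ?_
    rw [hmem]
    constructor
    · rintro ⟨⟨x, l⟩, h⟩
      exact ⟨x, (hQ _ _).2 ⟨l, h⟩⟩
    · rintro ⟨x, h⟩
      obtain ⟨l, h⟩ := (hQ _ _).1 h
      exact ⟨⟨x, l⟩, h⟩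
  -- Non-membership: search for a finite model with a marked set that contains the image of the
  -- submonoid and misses the given word.
  · obtain ⟨Q, hQ⟩ := exists_list_of_finite hR
    have _ := Fintype.ofFinite B
    have _ := Fintype.ofFinite Γ
    let L : List (B × Bool) := (Finset.univ : Finset (B × Bool)).toList
    let G : List (List (B × Bool)) :=
      (Finset.univ : Finset Γ).toList.map fun j => FreeMonoid.toList (Ψ j)
    have : PrimrecPred fun a : List (Fin k) × Table =>
        a.2.IsModel L Q ∧ a.2.IsClosed G ∧ ¬ a.2.Marked (a.2.eval (U a.1)) :=
      ((Table.primrecPred_isModel L Q).comp Primrec.snd).and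
        (((Table.primrecPred_isClosed G).comp Primrec.snd).and
          (Table.primrecPred_marked Primrec.snd
            (Table.primrec_eval Primrec.snd (hpU.comp Primrec.fst))).not)
    refine (rePred_exists this).of_eq fun w => ?_
    rw [hmem]
    constructor
    · rintro ⟨c, hc, hcl, hn⟩ ⟨x, hx⟩
      obtain ⟨h1, h2⟩ := hc.exists_hom (fun l => by simp [L]) fun x y h => (hQ _ _).2 h
      refine hn ?_
      have h3 := h1 _ _ hx
      rw [FreeMonoid.toList_ofList, FreeMonoid.toList_ofList] at h3
      rw [← h3]
      have lt : ∀ y : List (B × Bool), c.eval y < c.size := by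
        intro y
        rw [← List.append_nil y, h2]
        exact c.op_lt _ _
      clear hx h3
      -- Words grow on the right, so closure under right multiplication by the generators suffices;
      -- the marked set need not be a submonoid.
      induction x using List.reverseRecOn with
      | nil => exact hcl.1
      | append_singleton x j ih =>
        have e : V (x ++ [j]) = V x ++ FreeMonoid.toList (Ψ j) := by simp [V]
        rw [e, h2]
        exact hcl.2 _ (lt _) _ (List.mem_map.2 ⟨j, by simp, rfl⟩) ih
    · intro hn
      -- For completeness of the search, the Rees quotient at the given element is the model, with
      -- the image of the submonoid marked.
      have := finite_factorCon_quotient (hJ ((presCon R).mk' (FreeMonoid.ofList (U w))))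
      let ρ := (factorCon ((presCon R).mk' (FreeMonoid.ofList (U w)))).mk'
      let φ := ρ.comp (presCon R).mk'
      obtain ⟨c, h1, h2, h3⟩ := Table.exists_isModel φ
        (Con.mk'_surjective.comp Con.mk'_surjective) (R := R)
        (fun x y h => congrArg ρ ((Con.eq _).2 h)) L (fun x y h => (hQ x y).1 h) (G := G)
        (MonoidHom.mrange (φ.comp (FreeMonoid.lift Ψ))) (by
          intro y hy
          obtain ⟨j, -, rfl⟩ := List.mem_map.1 hy
          exact ⟨FreeMonoid.of j, by
            rw [MonoidHom.comp_apply, FreeMonoid.lift_eval_of, FreeMonoid.ofList_toList]⟩)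
      refine ⟨c, h1, h2, fun h => hn ?_⟩
      obtain ⟨x, hx⟩ := (h3 _).1 h
      refine ⟨FreeMonoid.toList x, ?_⟩
      rw [← hV, FreeMonoid.ofList_toList]
      -- A coincidence in the quotient lifts to the monoid, because the class of the given element
      -- is a singleton.
      exact (Con.eq _).1 (factorCon_eq ((Con.eq _).1 hx.symm)).symm

/-- The input is a word of indices, so pulling the family back along `e` leaves the algorithm as it
is; `e` need not be effective. -/
theorem DecidableMembership.of_mulEquiv {M N : Type u} [Monoid M] [Monoid N] (e : M ≃* N)
    {L : Set N} (h : DecidableMembership M (e ⁻¹' L)) : DecidableMembership N L := by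
  intro k g
  have := h k fun j => e.symm (g j)
  have h2 : ∀ w : List (Fin k), e (w.map fun j => e.symm (g j)).prod = (w.map g).prod := by
    intro w
    rw [map_list_prod, List.map_map]
    congr 2
    funext j
    simp
  refine this.of_eq fun w => ?_
  rw [Set.mem_preimage, h2]

theorem FiniteJAbove.of_mulEquiv {M N : Type u} [Monoid M] [Monoid N] (e : M ≃* N)
    (h : FiniteJAbove N) : FiniteJAbove M := by
  intro v
  refine Set.Finite.of_finite_image (f := e) ((h (e v)).subset ?_) e.injective.injOn
  rintro _ ⟨x, ⟨p, q, rfl⟩, rfl⟩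
  exact ⟨e p, e q, by simp⟩

/-- Each component of a factor is a factor of the corresponding component. -/
theorem FiniteJAbove.pi {ι : Type u} [Finite ι] {M : ι → Type u} [∀ i, Monoid (M i)]
    (h : ∀ i, FiniteJAbove (M i)) : FiniteJAbove (∀ i, M i) := by
  intro v
  refine (Set.Finite.pi fun i => h i (v i)).subset ?_
  rintro x ⟨p, q, rfl⟩ i -
  exact ⟨p i, q i, rfl⟩

/-! ### Presentation of a finite direct product -/

section Product

variable {ι : Type u} {B : ι → Type u}

/-- The inclusion of the words over one alphabet into those over the disjoint union. -/
def incl (i : ι) : Word (B i) →* Word (Σ i, B i) := FreeMonoid.map (Prod.map (Sigma.mk i) id)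

theorem incl_wordInv (i : ι) (w : Word (B i)) : incl i (wordInv w) = wordInv (incl i w) := by
  induction w using FreeMonoid.inductionOn' with
  | one => rfl
  | of_mul l w ih =>
    rw [wordInv_mul, map_mul, map_mul, wordInv_mul, ih]
    rfl

/-- The projection of words over a disjoint union of alphabets onto the words over one of them. -/
def proj [DecidableEq ι] (i : ι) : Word (Σ i, B i) →* Word (B i) :=
  FreeMonoid.lift fun l : (Σ i, B i) × Bool =>
    if h : l.1.1 = i then FreeMonoid.of (h ▸ l.1.2, l.2) else 1

theorem proj_of_self [DecidableEq ι] (i : ι) (l : B i × Bool) :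
    proj i (FreeMonoid.of ((⟨i, l.1⟩ : Σ i, B i), l.2)) = FreeMonoid.of l := by
  simp [proj, FreeMonoid.lift_eval_of]

theorem proj_of_ne [DecidableEq ι] {i : ι} {l : (Σ i, B i) × Bool} (h : l.1.1 ≠ i) :
    proj i (FreeMonoid.of l) = 1 := by
  simp [proj, FreeMonoid.lift_eval_of, h]

theorem proj_wordInv [DecidableEq ι] (i : ι) (w : Word (Σ i, B i)) :
    proj i (wordInv w) = wordInv (proj i w) := by
  induction w using FreeMonoid.inductionOn' with
  | one => rfl
  | of_mul l w ih =>
    rw [wordInv_mul, map_mul, map_mul, wordInv_mul, ih, wordInv_of]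
    congr 1
    by_cases h : l.1.1 = i
    · obtain ⟨⟨j, b⟩, s⟩ := l
      subst h
      exact (proj_of_self j (b, !s)).trans (congrArg wordInv (proj_of_self j (b, s))).symm
    · rw [proj_of_ne h, proj_of_ne (l := (l.1, !l.2)) h]
      rfl

theorem proj_incl_self [DecidableEq ι] (i : ι) (w : Word (B i)) : proj i (incl i w) = w := by
  induction w using FreeMonoid.inductionOn' with
  | one => rfl
  | of_mul l w ih => rw [map_mul, map_mul, ih]; exact congrArg (· * w) (proj_of_self i l)

theorem proj_incl_of_ne [DecidableEq ι] {i j : ι} (h : j ≠ i) (w : Word (B j)) :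
    proj i (incl j w) = 1 := by
  induction w using FreeMonoid.inductionOn' with
  | one => rfl
  | of_mul l w ih =>
    rw [map_mul, map_mul, ih, mul_one]
    exact proj_of_ne (l := ((⟨j, l.1⟩ : Σ i, B i), l.2)) h

/-- The relations of a direct product: those of the factors, and commutation of letters from
distinct factors. -/
def prodRel (R : ∀ i, Set (Word (B i) × Word (B i))) :
    Set (Word (Σ i, B i) × Word (Σ i, B i)) :=
  (⋃ i, Prod.map (incl i) (incl i) '' R i) ∪
    (fun p : ((Σ i, B i) × Bool) × ((Σ i, B i) × Bool) =>
      (FreeMonoid.of p.1 * FreeMonoid.of p.2, FreeMonoid.of p.2 * FreeMonoid.of p.1)) ''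
        {p | p.1.1.1 ≠ p.2.1.1}

theorem finite_prodRel [Finite ι] [∀ i, Finite (B i)] {R : ∀ i, Set (Word (B i) × Word (B i))}
    (hR : ∀ i, (R i).Finite) : (prodRel R).Finite :=
  (Set.finite_iUnion fun i => (hR i).image _).union (Set.toFinite _)

variable (R : ∀ i, Set (Word (B i) × Word (B i)))

theorem presCon_prodRel_le [DecidableEq ι] (i : ι) :
    presCon (prodRel R) ≤ Con.ker ((presCon (R i)).mk'.comp (proj i)) := by
  refine presCon_le ?_ ?_
  · rintro x y (w | ⟨x, y⟩)
    · refine (Con.eq _).2 (presCon_of_vagner _ ?_)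
      simpa only [map_mul, proj_wordInv] using VagnerRel.inv_law (proj i y)
    · refine (Con.eq _).2 (presCon_of_vagner _ ?_)
      simpa only [map_mul, proj_wordInv] using VagnerRel.comm_law (proj i x) (proj i y)
  · rintro x y (h | ⟨⟨l, l'⟩, hl, h⟩)
    · obtain ⟨j, ⟨r, s⟩, hr, h⟩ := Set.mem_iUnion.1 h
      cases h
      refine (Con.eq _).2 ?_
      by_cases hj : j = i
      · subst hj
        rw [proj_incl_self, proj_incl_self]
        exact presCon_of_mem hr
      · rw [proj_incl_of_ne hj, proj_incl_of_ne hj]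
        exact (presCon _).refl _
    · cases h
      refine (Con.eq _).2 ?_
      change presCon (R i) (proj i (FreeMonoid.of l * FreeMonoid.of l'))
        (proj i (FreeMonoid.of l' * FreeMonoid.of l))
      rw [map_mul (proj i), map_mul (proj i)]
      by_cases h1 : l.1.1 = i
      · rw [proj_of_ne (l := l') fun h2 => hl (h1.trans h2.symm), one_mul, mul_one]
        exact (presCon _).refl _
      · rw [proj_of_ne h1, one_mul, mul_one]
        exact (presCon _).refl _

/-- The homomorphism from the monoid presented by the product presentation to the product. -/
def toPi [DecidableEq ι] : Presented (prodRel R) →* ∀ i, Presented (R i) :=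
  MonoidHom.pi fun i => (presCon (prodRel R)).lift _ (presCon_prodRel_le R i)

theorem presCon_le_ker_incl (i : ι) :
    presCon (R i) ≤ Con.ker ((presCon (prodRel R)).mk'.comp (incl i)) := by
  refine presCon_le ?_ ?_
  · rintro x y (w | ⟨x, y⟩)
    · refine (Con.eq _).2 (presCon_of_vagner _ ?_)
      simpa only [map_mul, incl_wordInv] using VagnerRel.inv_law (incl i y)
    · refine (Con.eq _).2 (presCon_of_vagner _ ?_)
      simpa only [map_mul, incl_wordInv] using VagnerRel.comm_law (incl i x) (incl i y)
  · intro x y h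
    exact (Con.eq _).2 (presCon_of_mem (Or.inl (Set.mem_iUnion.2 ⟨i, (x, y), h, rfl⟩)))

/-- The inclusion of a factor into the monoid presented by the product presentation. -/
def ofFactor (i : ι) : Presented (R i) →* Presented (prodRel R) :=
  (presCon (R i)).lift _ (presCon_le_ker_incl R i)

theorem ofFactor_mk (i : ι) (w : Word (B i)) :
    ofFactor R i ((presCon (R i)).mk' w) = (presCon (prodRel R)).mk' (incl i w) := rfl

/-- Induction on both words reduces this to single letters, where it is a defining relation:
`prodRel` makes signed letters commute, inverses included. -/
theorem commute_ofFactor {i j : ι} (h : i ≠ j) (x : Presented (R i)) (y : Presented (R j)) :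
    Commute (ofFactor R i x) (ofFactor R j y) := by
  obtain ⟨x, rfl⟩ := Con.mk'_surjective x
  obtain ⟨y, rfl⟩ := Con.mk'_surjective y
  rw [ofFactor_mk, ofFactor_mk]
  induction x using FreeMonoid.inductionOn' with
  | one => rw [map_one, map_one]; exact Commute.one_left _
  | of_mul l x ih =>
    rw [map_mul, map_mul]
    refine Commute.mul_left ?_ ih
    clear ih
    induction y using FreeMonoid.inductionOn' with
    | one => rw [map_one, map_one]; exact Commute.one_right _
    | of_mul l' y ih =>
      rw [map_mul, map_mul]
      refine Commute.mul_right ?_ ih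
      exact (Con.eq _).2 (presCon_of_mem (Or.inr
        ⟨(((⟨i, l.1⟩ : Σ i, B i), l.2), ((⟨j, l'.1⟩ : Σ i, B i), l'.2)), h, rfl⟩))

theorem toPi_mk [DecidableEq ι] (w : Word (Σ i, B i)) (i : ι) :
    toPi R ((presCon (prodRel R)).mk' w) i = (presCon (R i)).mk' (proj i w) := rfl

theorem toPi_ofFactor [DecidableEq ι] (i : ι) (x : Presented (R i)) :
    toPi R (ofFactor R i x) = Pi.mulSingle i x := by
  obtain ⟨x, rfl⟩ := Con.mk'_surjective x
  rw [ofFactor_mk]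
  funext j
  rw [toPi_mk]
  by_cases h : i = j
  · subst h
    rw [proj_incl_self, Pi.mulSingle_eq_same]
  · rw [proj_incl_of_ne h, Pi.mulSingle_eq_of_ne (Ne.symm h), map_one]

/-- The product presentation presents the direct product. -/
theorem nonempty_mulEquiv_pi [Finite ι] :
    Nonempty (Presented (prodRel R) ≃* ∀ i, Presented (R i)) := by
  classical
  have _ := Fintype.ofFinite ι
  have hcomm : Pairwise fun i j => ∀ x y, Commute (ofFactor R i x) (ofFactor R j y) :=
    fun i j h x y => commute_ofFactor R h x y
  -- The inverse map multiplies the embedded components, in an order that is irrelevant because they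
  -- commute. Both composites are checked on generators.
  let G : (∀ i, Presented (R i)) →* Presented (prodRel R) :=
    MonoidHom.noncommPiCoprod (ofFactor R) hcomm
  have hG : ∀ i x, G (Pi.mulSingle i x) = ofFactor R i x :=
    fun i x => MonoidHom.noncommPiCoprod_mulSingle (ofFactor R) (hcomm := hcomm) i x
  refine ⟨MonoidHom.toMulEquiv (toPi R) G ?_ ?_⟩
  · refine Con.hom_ext (FreeMonoid.hom_eq ?_)
    rintro ⟨⟨i, b⟩, s⟩
    change G (toPi R (ofFactor R i ((presCon (R i)).mk' (FreeMonoid.of (b, s))))) = _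
    rw [toPi_ofFactor, hG]
    rfl
  · refine MonoidHom.pi_ext fun i x => ?_
    rw [MonoidHom.comp_apply, hG, toPi_ofFactor]
    rfl

end Product

/-- The membership problem for finitely generated submonoids of a finite direct product of
finitely presented finite-J-above inverse monoids is decidable. -/
theorem decidableMembership_pi_range {ι : Type u} [Finite ι] {B : ι → Type u} [∀ i, Finite (B i)]
    {R : ∀ i, Set (Word (B i) × Word (B i))} (hR : ∀ i, (R i).Finite)
    (hJ : ∀ i, FiniteJAbove (Presented (R i))) {Γ : Type u} [Finite Γ]
    (ψ : FreeMonoid Γ →* ∀ i, Presented (R i)) :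
    DecidableMembership (∀ i, Presented (R i)) (Set.range ψ) := by
  obtain ⟨e⟩ := nonempty_mulEquiv_pi R
  refine DecidableMembership.of_mulEquiv e ?_
  have h := decidableMembership_range (finite_prodRel hR)
    ((FiniteJAbove.pi hJ).of_mulEquiv e) (e.symm.toMonoidHom.comp ψ)
  convert h using 1
  ext x
  simp only [Set.mem_preimage, Set.mem_range, MonoidHom.comp_apply]
  exact exists_congr fun w => (MulEquiv.symm_apply_eq e).symm

/-- Commuting idempotents can be reordered and repetitions merged. When `a` is added to `F`, each
product is therefore an old one or `f a` times an old one. -/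
theorem finite_list_prod_of_commute {M α : Type*} [Monoid M] (f : α → M)
    (hi : ∀ a, f a * f a = f a) (hc : ∀ a b, Commute (f a) (f b)) {F : Set α} (hF : F.Finite) :
    {x | ∃ L : List α, (∀ a ∈ L, a ∈ F) ∧ (L.map f).prod = x}.Finite := by
  induction F, hF using Set.Finite.induction_on with
  | empty =>
    refine (Set.finite_singleton 1).subset ?_
    rintro _ ⟨L, hL, rfl⟩
    rw [List.eq_nil_iff_forall_not_mem.2 hL]
    rfl
  | @insert a F _ _ ih =>
    refine (ih.union (ih.image (f a * ·))).subset ?_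
    rintro _ ⟨L, hL, rfl⟩
    induction L with
    | nil => exact Or.inl ⟨[], by simp, rfl⟩
    | cons b L ihL =>
      rw [List.map_cons, List.prod_cons]
      have hb := hL b (by simp)
      rcases ihL fun c hc => hL c (by simp [hc]) with h | ⟨y, ⟨K, hK, hy⟩, h⟩
      · rcases hb with rfl | hb
        · exact Or.inr ⟨_, h, rfl⟩
        · obtain ⟨K, hK, hy⟩ := h
          rw [← hy]
          refine Or.inl ⟨b :: K, ?_, by simp⟩
          simpa using ⟨hb, hK⟩
      · refine Or.inr ?_
        rw [← h]
        rcases hb with rfl | hb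
        · exact ⟨y, ⟨K, hK, hy⟩, by simp only [← mul_assoc, hi]⟩
        · refine ⟨f b * y, ⟨b :: K, by simpa using ⟨hb, hK⟩, by simp [hy]⟩, ?_⟩
          simp only [← mul_assoc, (hc a b).eq]

/-! ### Munn trees and the free inverse monoid -/

section Munn

variable {A : Type u}

/-- The vertices of the Munn tree of a word. -/
def munnTree : List (A × Bool) → Set (FreeGroup A)
  | [] => {1}
  | l :: w => {g | g = 1 ∨ (FreeGroup.mk [l])⁻¹ * g ∈ munnTree w}

theorem mem_munnTree_cons {l : A × Bool} {w : List (A × Bool)} {g : FreeGroup A} :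
    g ∈ munnTree (l :: w) ↔ g = 1 ∨ (FreeGroup.mk [l])⁻¹ * g ∈ munnTree w := Iff.rfl

theorem mk_cons (l : A × Bool) (w : List (A × Bool)) :
    FreeGroup.mk (l :: w) = FreeGroup.mk [l] * FreeGroup.mk w := by
  rw [FreeGroup.mul_mk]; rfl

theorem one_mem_munnTree (w : List (A × Bool)) : 1 ∈ munnTree w := by
  cases w
  · exact rfl
  · exact Or.inl rfl

theorem mk_mem_munnTree (w : List (A × Bool)) : FreeGroup.mk w ∈ munnTree w := by
  induction w with
  | nil => exact rfl
  | cons l w ih =>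
    refine Or.inr ?_
    rw [mk_cons l w, inv_mul_cancel_left]
    exact ih

theorem finite_munnTree (w : List (A × Bool)) : (munnTree w).Finite := by
  induction w with
  | nil => exact Set.finite_singleton _
  | cons l w ih =>
    refine ((Set.finite_singleton 1).union (ih.image (FreeGroup.mk [l] * ·))).subset ?_
    rintro g (h | h)
    · exact Or.inl h
    · exact Or.inr ⟨_, h, mul_inv_cancel_left _ _⟩

theorem mem_munnTree_append {u v : List (A × Bool)} {g : FreeGroup A} :
    g ∈ munnTree (u ++ v) ↔ g ∈ munnTree u ∨ (FreeGroup.mk u)⁻¹ * g ∈ munnTree v := by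
  induction u generalizing g with
  | nil =>
    have h1 : FreeGroup.mk ([] : List (A × Bool)) = 1 := rfl
    rw [List.nil_append, h1, inv_one, one_mul]
    refine ⟨Or.inr, ?_⟩
    rintro (h | h)
    · cases h
      exact one_mem_munnTree v
    · exact h
  | cons l u ih =>
    rw [List.cons_append, mem_munnTree_cons, mem_munnTree_cons, ih, mk_cons l u, mul_inv_rev,
      mul_assoc, or_assoc]

/-- The inverse word walks the same path backwards, so its tree is the original one translated to
start at the old endpoint. -/
theorem mem_munnTree_invRev {w : List (A × Bool)} {g : FreeGroup A} :
    g ∈ munnTree (FreeGroup.invRev w) ↔ FreeGroup.mk w * g ∈ munnTree w := by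
  induction w generalizing g with
  | nil =>
    have h1 : FreeGroup.mk ([] : List (A × Bool)) = 1 := rfl
    rw [h1, one_mul]
    rfl
  | cons l w ih =>
    have h1 : FreeGroup.invRev (l :: w) = FreeGroup.invRev w ++ FreeGroup.invRev [l] := by
      simp [FreeGroup.invRev]
    have h2 : FreeGroup.mk [(l.1, !l.2)] = (FreeGroup.mk [l])⁻¹ := by
      rw [FreeGroup.inv_mk]; rfl
    have h3 : FreeGroup.invRev [l] = [(l.1, !l.2)] := rfl
    have h4 : FreeGroup.mk (FreeGroup.invRev w) = (FreeGroup.mk w)⁻¹ := FreeGroup.inv_mk.symm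
    rw [h1, mem_munnTree_append, ih, h3, mem_munnTree_cons, h2, h4, mem_munnTree_cons, mk_cons l w,
      mul_assoc, inv_mul_cancel_left, inv_inv, inv_inv]
    have h5 : FreeGroup.mk [l] * (FreeGroup.mk w * g) ∈ munnTree ([] : List (A × Bool)) ↔
      FreeGroup.mk [l] * (FreeGroup.mk w * g) = 1 := Iff.rfl
    rw [h5]
    constructor
    · rintro (h | h | h)
      · exact Or.inr h
      · rw [h]
        exact Or.inr (one_mem_munnTree w)
      · exact Or.inl h
    · rintro (h | h)
      · exact Or.inr (Or.inr h)
      · exact Or.inl h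

/-- Words with equal Munn trees and equal endpoints. -/
def munnCon (A : Type u) : Con (Word A) where
  r x y := FreeGroup.mk (FreeMonoid.toList x) = FreeGroup.mk (FreeMonoid.toList y) ∧
    munnTree (FreeMonoid.toList x) = munnTree (FreeMonoid.toList y)
  iseqv := ⟨fun _ => ⟨rfl, rfl⟩, fun h => ⟨h.1.symm, h.2.symm⟩,
    fun h h' => ⟨h.1.trans h'.1, h.2.trans h'.2⟩⟩
  mul' := by
    rintro w x y z ⟨h1, h2⟩ ⟨h3, h4⟩
    simp only [FreeMonoid.toList_mul]
    refine ⟨by rw [← FreeGroup.mul_mk, ← FreeGroup.mul_mk, h1, h3], ?_⟩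
    ext g
    rw [mem_munnTree_append, mem_munnTree_append, h1, h2, h4]

/-- The word `w * wordInv w` ends at `1` and has the same tree as `w`. Multiplying such words takes
unions of trees, which is commutative and idempotent. Only this soundness half of Munn's theorem is
needed. -/
theorem presCon_empty_le_munnCon : presCon (∅ : Set (Word A × Word A)) ≤ munnCon A := by
  refine presCon_le ?_ fun _ _ h => h.elim
  have key : ∀ w : List (A × Bool), FreeGroup.mk (w ++ FreeGroup.invRev w) = 1 := by
    intro w
    rw [← FreeGroup.mul_mk, ← FreeGroup.inv_mk, mul_inv_cancel]
  have key2 : ∀ (w : List (A × Bool)) (g : FreeGroup A),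
      g ∈ munnTree (w ++ FreeGroup.invRev w) ↔ g ∈ munnTree w := by
    intro w g
    rw [mem_munnTree_append, mem_munnTree_invRev, mul_inv_cancel_left, or_self]
  rintro x y (w | ⟨x, y⟩)
  · change FreeGroup.mk (FreeMonoid.toList y ++ FreeGroup.invRev (FreeMonoid.toList y) ++
      FreeMonoid.toList y) = _ ∧ munnTree (FreeMonoid.toList y ++
        FreeGroup.invRev (FreeMonoid.toList y) ++ FreeMonoid.toList y) = _
    refine ⟨by rw [← FreeGroup.mul_mk, key, one_mul], ?_⟩
    ext g
    rw [mem_munnTree_append, key2, key, inv_one, one_mul, or_self]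
  · change FreeGroup.mk (FreeMonoid.toList x ++ FreeGroup.invRev (FreeMonoid.toList x) ++
      (FreeMonoid.toList y ++ FreeGroup.invRev (FreeMonoid.toList y))) =
      FreeGroup.mk (FreeMonoid.toList y ++ FreeGroup.invRev (FreeMonoid.toList y) ++
      (FreeMonoid.toList x ++ FreeGroup.invRev (FreeMonoid.toList x))) ∧
      munnTree (FreeMonoid.toList x ++ FreeGroup.invRev (FreeMonoid.toList x) ++
      (FreeMonoid.toList y ++ FreeGroup.invRev (FreeMonoid.toList y))) =
      munnTree (FreeMonoid.toList y ++ FreeGroup.invRev (FreeMonoid.toList y) ++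
      (FreeMonoid.toList x ++ FreeGroup.invRev (FreeMonoid.toList x)))
    refine ⟨by rw [← FreeGroup.mul_mk, key, key, ← FreeGroup.mul_mk, key, key], ?_⟩
    ext g
    simp only [mem_munnTree_append (u := _ ++ FreeGroup.invRev _), key, inv_one, one_mul, key2, or_comm]

/-- Right multiplication by a letter either extends the reduced word or cancels its last letter. As
`FreeGroup.reduce` recurses from the left, the proof passes to inverses. -/
theorem toWord_mul_mk_singleton [DecidableEq A] (g : FreeGroup A) (l : A × Bool) :
    (g * FreeGroup.mk [l]).toWord = g.toWord ++ [l] ∨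
      g.toWord = (g * FreeGroup.mk [l]).toWord ++ [(l.1, !l.2)] := by
  have h1 : (g * FreeGroup.mk [l])⁻¹ = FreeGroup.mk [(l.1, !l.2)] * g⁻¹ := by
    rw [mul_inv_rev, FreeGroup.inv_mk]; rfl
  have h2 : (g * FreeGroup.mk [l]).toWord =
      FreeGroup.invRev (FreeGroup.mk [(l.1, !l.2)] * g⁻¹).toWord := by
    rw [← h1, FreeGroup.toWord_inv, FreeGroup.invRev_invRev]
  have h3 : g.toWord = FreeGroup.invRev g⁻¹.toWord := by
    rw [FreeGroup.toWord_inv, FreeGroup.invRev_invRev]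
  have h4 : (FreeGroup.mk [(l.1, !l.2)] * g⁻¹).toWord =
      FreeGroup.reduce ((l.1, !l.2) :: g⁻¹.toWord) := by
    rw [FreeGroup.toWord_mul, FreeGroup.toWord_mk, FreeGroup.reduce_singleton]; rfl
  rw [FreeGroup.reduce.cons, FreeGroup.reduce_toWord] at h4
  rw [h2, h3, h4]
  rcases g⁻¹.toWord with _ | ⟨⟨b, t⟩, w⟩
  · left
    simp [FreeGroup.invRev]
  · dsimp only
    split_ifs with h
    · right
      obtain ⟨e1, e2⟩ := h
      subst e1
      have : l.2 = t := by simpa using e2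
      simp [FreeGroup.invRev, this]
    · left
      simp [FreeGroup.invRev]

variable (A) in
/-- The projection of words onto the free inverse monoid. -/
abbrev toFree : Word A →* Presented (∅ : Set (Word A × Word A)) :=
  (presCon (∅ : Set (Word A × Word A))).mk'

theorem toFree_inv_law (w : Word A) :
    toFree A w * toFree A (wordInv w) * toFree A w = toFree A w := by
  rw [← map_mul, ← map_mul]
  exact (Con.eq _).2 (presCon_of_vagner _ (.inv_law w))

theorem toFree_comm_law (x y : Word A) :
    Commute (toFree A x * toFree A (wordInv x)) (toFree A y * toFree A (wordInv y)) := by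
  unfold Commute SemiconjBy
  simp only [← map_mul]
  exact (Con.eq _).2 (presCon_of_vagner _ (.comm_law x y))

/-- The idempotent of the free inverse monoid given by the geodesic to a vertex. -/
def vertexIdem [DecidableEq A] (g : FreeGroup A) : Presented (∅ : Set (Word A × Word A)) :=
  toFree A (FreeMonoid.ofList g.toWord) * toFree A (wordInv (FreeMonoid.ofList g.toWord))

theorem vertexIdem_mul_self [DecidableEq A] (g : FreeGroup A) :
    vertexIdem g * vertexIdem g = vertexIdem g := by
  unfold vertexIdem
  rw [← mul_assoc, toFree_inv_law]

theorem commute_vertexIdem [DecidableEq A] (g h : FreeGroup A) :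
    Commute (vertexIdem g) (vertexIdem h) :=
  toFree_comm_law _ _

theorem vertexIdem_mul_toFree [DecidableEq A] (g : FreeGroup A) :
    vertexIdem g * toFree A (FreeMonoid.ofList g.toWord) = toFree A (FreeMonoid.ofList g.toWord) :=
  toFree_inv_law _

/-- A word equals a product of idempotents at vertices of its Munn tree, times the reduced word. -/
theorem exists_toFree_eq [DecidableEq A] (w : List (A × Bool)) :
    ∃ L : List (FreeGroup A), (∀ g ∈ L, g ∈ munnTree w) ∧
      (L.map vertexIdem).prod * vertexIdem (FreeGroup.mk w) = (L.map vertexIdem).prod ∧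
      toFree A (FreeMonoid.ofList w) = (L.map vertexIdem).prod *
        toFree A (FreeMonoid.ofList (FreeGroup.mk w).toWord) := by
  induction w using List.reverseRecOn with
  | nil =>
    refine ⟨[], by simp, ?_, ?_⟩
    · have : FreeGroup.mk ([] : List (A × Bool)) = 1 := rfl
      rw [this, vertexIdem, FreeGroup.toWord_one]
      simp only [List.map_nil, List.prod_nil, one_mul]
      rfl
    · have : FreeGroup.mk ([] : List (A × Bool)) = 1 := rfl
      rw [this, FreeGroup.toWord_one, List.map_nil, List.prod_nil, one_mul]
  | append_singleton w l ih =>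
    obtain ⟨L, hL, h1, h2⟩ := ih
    -- The appended idempotent belongs to the new endpoint. It keeps the absorption clause true and
    -- is itself absorbed by the reduced word that follows.
    refine ⟨L ++ [FreeGroup.mk (w ++ [l])], ?_, ?_, ?_⟩
    · intro g hg
      rcases List.mem_append.1 hg with h | h
      · exact mem_munnTree_append.2 (Or.inl (hL g h))
      · rw [List.mem_singleton.1 h]
        exact mk_mem_munnTree _
    · simp only [List.map_append, List.prod_append, List.map_cons, List.map_nil, List.prod_singleton,
        mul_assoc, vertexIdem_mul_self]
    · simp only [List.map_append, List.prod_append, List.map_cons, List.map_nil, List.prod_singleton,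
        mul_assoc, vertexIdem_mul_toFree]
      rw [FreeMonoid.ofList_append, map_mul, h2, ← FreeGroup.mul_mk]
      rcases toWord_mul_mk_singleton (FreeGroup.mk w) l with h | h
      · rw [h, FreeMonoid.ofList_append, map_mul, mul_assoc]
      · set x := (FreeGroup.mk w * FreeGroup.mk [l]).toWord
        rw [vertexIdem] at h1
        have hl : FreeMonoid.ofList [l] = wordInv (FreeMonoid.ofList [(l.1, !l.2)]) := by
          rw [FreeMonoid.ofList_singleton, FreeMonoid.ofList_singleton, wordInv_of]
          simp
        have hc := toFree_comm_law (wordInv (FreeMonoid.ofList x)) (FreeMonoid.ofList [(l.1, !l.2)])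
        have hi := toFree_inv_law (FreeMonoid.ofList x)
        rw [wordInv_wordInv] at hc
        rw [h, FreeMonoid.ofList_append, wordInv_mul, map_mul, map_mul] at h1
        rw [h, FreeMonoid.ofList_append, map_mul, hl]
        generalize toFree A (FreeMonoid.ofList x) = H at *
        generalize toFree A (wordInv (FreeMonoid.ofList x)) = H' at *
        generalize toFree A (FreeMonoid.ofList [(l.1, !l.2)]) = k at *
        generalize toFree A (wordInv (FreeMonoid.ofList [(l.1, !l.2)])) = k' at *
        generalize (L.map vertexIdem).prod = E at *
        -- The cancelling case: `H * k` is the old reduced word and `k'` the new letter. Commuting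
        -- `H' * H` past `k * k'` exposes the idempotent of the old endpoint, which `E` absorbs by
        -- `h1`.
        calc E * (H * k) * k' = E * (H * H' * H * k) * k' := by rw [hi]
          _ = E * (H * ((H' * H) * (k * k'))) := by simp only [mul_assoc]
          _ = E * (H * ((k * k') * (H' * H))) := by rw [hc.eq]
          _ = E * (H * k * (k' * H')) * H := by simp only [mul_assoc]
          _ = E * H := by rw [h1]

/-- Free inverse monoids are finite-J-above. -/
theorem finiteJAbove_free : FiniteJAbove (Presented (∅ : Set (Word A × Word A))) := by
  classical
  intro v
  obtain ⟨v, rfl⟩ := Con.mk'_surjective v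
  set T := munnTree (FreeMonoid.toList v)
  have hT : T.Finite := finite_munnTree _
  -- If `v = p * x * q`, the tree of `x` translated by the endpoint of `p` lies in `T`, and so does
  -- that endpoint. Hence the tree of `x` lies in this finite set, whichever `p` and `q` occur.
  have hF : (Set.image2 (fun a b : FreeGroup A => a⁻¹ * b) T T).Finite := hT.image2 _ hT
  have hP := finite_list_prod_of_commute (vertexIdem (A := A)) vertexIdem_mul_self
    commute_vertexIdem hF
  refine (hP.image2 (· * ·) (hF.image fun g => toFree A (FreeMonoid.ofList g.toWord))).subset ?_
  rintro x ⟨p, q, h⟩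
  obtain ⟨x, rfl⟩ := Con.mk'_surjective x
  obtain ⟨p, rfl⟩ := Con.mk'_surjective p
  obtain ⟨q, rfl⟩ := Con.mk'_surjective q
  rw [← map_mul, ← map_mul] at h
  have hv : T = munnTree (FreeMonoid.toList p ++ FreeMonoid.toList x ++ FreeMonoid.toList q) :=
    (presCon_empty_le_munnCon ((Con.eq _).1 h)).2
  have hp : FreeGroup.mk (FreeMonoid.toList p) ∈ T := by
    rw [hv]
    exact mem_munnTree_append.2 (Or.inl (mem_munnTree_append.2 (Or.inl (mk_mem_munnTree _))))
  have hx : ∀ g ∈ munnTree (FreeMonoid.toList x),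
      g ∈ Set.image2 (fun a b : FreeGroup A => a⁻¹ * b) T T := by
    intro g hg
    refine ⟨_, hp, FreeGroup.mk (FreeMonoid.toList p) * g, ?_, inv_mul_cancel_left _ _⟩
    rw [hv]
    refine mem_munnTree_append.2 (Or.inl (mem_munnTree_append.2 (Or.inr ?_)))
    rwa [inv_mul_cancel_left]
  obtain ⟨L, hL, -, h2⟩ := exists_toFree_eq (FreeMonoid.toList x)
  -- Both parts of the normal form range over finite sets: the product of vertex idempotents and the
  -- reduced word of the endpoint.
  exact ⟨_, ⟨L, fun g hg => hx g (hL g hg), rfl⟩, _, ⟨_, hx _ (mk_mem_munnTree _), rfl⟩, h2.symm⟩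

end Munn

end InvPres

/-! ### The eraser morphism -/

theorem corollary4p6 {A : Type u} [Finite A] [DecidableEq A] :
    (∀ R : Set (InvPres.Word A × InvPres.Word A), R.Finite →
      (∀ a : A, InvPres.FiniteJAbove (InvPres.Component R a)) →
      InvPres.DecidableMembership ((a : A) → InvPres.Component R a)
        (Set.range (InvPres.eraser R))) ∧
    InvPres.DecidableMembership
      ((a : A) → InvPres.Component (∅ : Set (InvPres.Word A × InvPres.Word A)) a)
      (Set.range (InvPres.eraser (∅ : Set (InvPres.Word A × InvPres.Word A)))) := by
  have key : ∀ R : Set (InvPres.Word A × InvPres.Word A), R.Finite →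
      (∀ a : A, InvPres.FiniteJAbove (InvPres.Component R a)) →
      InvPres.DecidableMembership ((a : A) → InvPres.Component R a)
        (Set.range (InvPres.eraser R)) := by
    intro R hR hJ
    -- Precomposing with the surjective quotient map from words does not change the range, and it
    -- makes the domain a free monoid on the finite set `A × Bool`.
    have h := InvPres.decidableMembership_pi_range (R := InvPres.erasedRel R)
      (fun a => hR.image _) hJ ((InvPres.eraser R).comp (InvPres.presCon R).mk')
    rwa [MonoidHom.coe_comp, Con.mk'_surjective.range_comp] at h
  refine ⟨key, key ∅ Set.finite_empty fun a => ?_⟩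
  have h : InvPres.erasedRel (∅ : Set (InvPres.Word A × InvPres.Word A)) a = ∅ :=
    Set.image_empty _
  unfold InvPres.Component
  rw [h]
  exact InvPres.finiteJAbove_free
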